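/- Let $n\ge 3$ and $m\ge 1$ be integers. Each of $n$ parties chooses an input $s_i\in\{0,\dots,m-1\}$ and obtains a binary output $r_i\in\{0,1\}$; write $P(\vec r\,|\,\vec s)$ for the resulting correlation. Let $[X]_d\in\{0,\dots,d-1\}$ denote the residue of $X$ modulo $d$. For $f:\{0,\dots,m-1\}\times\{0,1\}\to\mathbb R$ define the Bell expression $$S_{n,m,2;f}(P)=\sum_{\vec s\in\{0,\dots,m-1\}^n}\ \sum_{r=0}^{1} f\Big(\big[\textstyle\sum_i s_i\big]_m,\ \big[r-\lfloor \tfrac1m\sum_i s_i\rfloor\big]_2\Big)\ P\Big(\big[\textstyle\sum_i r_i\big]_2=r\ \Big|\ \vec s\Big).$$ Call $P$ quantum biseparable if there are Hilbert spaces $\mathcal H_1,\dots,\mathcal H_n$ of arbitrary dimension, local measurements (POVMs) $\{M^{(i)}_{r|s}\}_{r=0,1}$ on $\mathcal H_i$ for every input $s$, and a state $\rho$ on $\mathcal H_1\otimes\dots\otimes\mathcal H_n$ that is a statistical mixture of pure states, each of which is a product state across some division of the $n$ parties into two nonempty groups (the division may vary within the mixture), such that $P(\vec r\,|\,\vec s)=\operatorname{tr}\big(\rho\,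 M^{(1)}_{r_1|s_1}\otimes\dots\otimes M^{(n)}_{r_n|s_n}\big)$. Then for every function $g:\{0,\dots,m-1\}\to\mathbb R$, with $f(s,r)=g(s)\cdot r$, every quantum biseparable correlation $P$ satisfies $$S_{n,m,2;\,g\cdot r}(P)\ \ge\ \frac12\, m^{n-2}\left( m\sum_{s=0}^{m-1} g(s)\;-\;\max_{j=0,\dots,m-1}\left[\eta_j\,\csc\!\Big(\frac{\eta_j\pi}{2m}\Big)\,\Big|\sum_{s=0}^{m-1} g(s)\,\omega_j^{\,s}\Big|\right]\right),$$ where $\eta_j=\gcd(2j+1,m)$ and $\omega_j=e^{i\pi(2j+1)/m}$. -/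

import Mathlib

universe u v

/-! ### Correlations and the symmetric full-correlation Bell expression -/

/-- A family of numbers `P s r`, to be read as `P(r₁ … rₙ | s₁ … sₙ)`, for `n` parties with
`m` inputs and `k` outputs each. -/
abbrev Correlation (n m k : ℕ) : Type := (Fin n → Fin m) → (Fin n → Fin k) → ℝ

/-- The sum, as a natural number, of the inputs (or of the outputs) of all parties. -/
def total {n d : ℕ} (x : Fin n → Fin d) : ℕ := ∑ i, (x i : ℕ)

/-- `[X]_d`, the representative of the integer `X` modulo `d` in `{0, …, d - 1}`. -/
def residue (d : ℕ) [NeZero d] (X : ℤ) : Fin d :=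
  ⟨(X % (d : ℤ)).toNat, by
    have hd : (0 : ℤ) < d := by exact_mod_cast Nat.pos_of_ne_zero (NeZero.ne d)
    have h0 := Int.emod_nonneg X hd.ne'
    have h1 := Int.emod_lt_of_pos X hd
    omega⟩

/-- The probability, for the inputs `s`, that the sum of all outputs is `r` modulo `k`. -/
noncomputable def probTotal {n m k : ℕ} [NeZero k] (P : Correlation n m k)
    (s : Fin n → Fin m) (r : Fin k) : ℝ :=
  ∑ o : Fin n → Fin k with residue k (total o) = r, P s o

/-- The Bell expression
`∑_s ∑_r f([∑ s]_m, [r - ⌊∑ s / m⌋]_k) P([∑ r]_k = r)`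
(the division `total s / m` is that of natural numbers, that is, the floor). -/
noncomputable def bellExpr {n m k : ℕ} [NeZero m] [NeZero k] (f : Fin m → Fin k → ℝ)
    (P : Correlation n m k) : ℝ :=
  ∑ s : Fin n → Fin m, ∑ r : Fin k,
    f (residue m (total s)) (residue k (((r : ℕ) : ℤ) - ((total s / m : ℕ) : ℤ)))
      * probTotal P s r

/-! ### Hilbert spaces, local operators and their tensor products

Every complex Hilbert space is isometric to `ℓ²(κ)` for some index type `κ`, of arbitrary
cardinality (an orthonormal basis), and the Hilbert space tensor product of the spaces `ℓ²(ι i)`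
is `ℓ²(Π i, ι i)`: the product vector `⊗ᵢ xᵢ` is the function `a ↦ ∏ᵢ xᵢ (a i)`. -/

/-- The complex Hilbert space with orthonormal basis labelled by `κ`. -/
abbrev L2 (κ : Type u) : Type u := lp (fun _ : κ => ℂ) 2

namespace L2

theorem summable_sq {κ : Type u} (ψ : L2 κ) : Summable fun a => ‖ψ a‖ ^ 2 := by
  have h := (lp.memℓp ψ).summable (by norm_num)
  simpa using h

theorem norm_sq {κ : Type u} (ψ : L2 κ) : ‖ψ‖ ^ 2 = ∑' a, ‖ψ a‖ ^ 2 := by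
  have h := lp.norm_rpow_eq_tsum (p := 2) (by norm_num) ψ
  simpa using h

theorem mem_of_summable {κ : Type u} {x : κ → ℂ} (h : Summable fun a => ‖x a‖ ^ 2) :
    Memℓp x 2 :=
  memℓp_gen (by simpa using h)

end L2

section Slot

variable {n : ℕ} {ι : Fin n → Type u}

/-- The vector `b ↦ ψ(a₁, …, b, …, aₙ)` (with `b` in the place `i`) of the `i`-th space. -/
noncomputable def slice (i : Fin n) (ψ : L2 (∀ j, ι j)) (a : ∀ j, ι j) : L2 (ι i) :=
  ⟨fun b => ψ (Function.update a i b), L2.mem_of_summable <|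
    (L2.summable_sq ψ).comp_injective (Function.update_injective a i)⟩

theorem slice_apply (i : Fin n) (ψ : L2 (∀ j, ι j)) (a : ∀ j, ι j) (b : ι i) :
    slice i ψ a b = ψ (Function.update a i b) := rfl

theorem update_symm_piSplitAt (i : Fin n) (b b' : ι i) (c : ∀ j : { j // j ≠ i }, ι j) :
    Function.update ((Equiv.piSplitAt i ι).symm (b, c)) i b'
      = (Equiv.piSplitAt i ι).symm (b', c) := by
  ext j
  by_cases h : j = i
  · subst h; simp
  · simp [h]

theorem slice_update (i : Fin n) (ψ : L2 (∀ j, ι j)) (a : ∀ j, ι j) (b : ι i) :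
    slice i ψ (Function.update a i b) = slice i ψ a := by
  apply lp.ext
  funext b'
  simp [slice_apply]

theorem slot_summable (i : Fin n) (M : L2 (ι i) →L[ℂ] L2 (ι i)) (ψ : L2 (∀ j, ι j)) :
    (Summable fun a => ‖M (slice i ψ a) (a i)‖ ^ 2) ∧
      ∑' a, ‖M (slice i ψ a) (a i)‖ ^ 2 ≤ ‖M‖ ^ 2 * ‖ψ‖ ^ 2 := by
  classical
  let e := ((Equiv.prodComm _ _).trans (Equiv.piSplitAt i ι).symm)
  have hψ : Summable fun q => ‖ψ (e q)‖ ^ 2 := e.summable_iff.2 (L2.summable_sq ψ)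
  have hψ' := (summable_prod_of_nonneg (fun q => by positivity)).1 hψ
  rcases isEmpty_or_nonempty (ι i) with hι | ⟨⟨b₀⟩⟩
  · have : IsEmpty (∀ j, ι j) := ⟨fun a => hι.elim (a i)⟩
    refine ⟨Summable.of_finite, ?_⟩
    rw [tsum_empty]; positivity
  have hs : ∀ c b, slice i ψ (e (c, b)) = slice i ψ (e (c, b₀)) := by
    intro c b
    rw [← slice_update i ψ (e (c, b₀)) b]
    congr 1
    exact (update_symm_piSplitAt i b₀ b c).symm
  have hei : ∀ c b, e (c, b) i = b := by
    intro c b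
    simp [e]
  have hn : ∀ c, ∑' b, ‖ψ (e (c, b))‖ ^ 2 = ‖slice i ψ (e (c, b₀))‖ ^ 2 := by
    intro c
    rw [L2.norm_sq]
    refine tsum_congr fun b => ?_
    rw [slice_apply]
    rw [show Function.update (e (c, b₀)) i b = e (c, b) from update_symm_piSplitAt i b₀ b c]
  have hm : ∀ c, ∑' b, ‖M (slice i ψ (e (c, b))) (e (c, b) i)‖ ^ 2
      = ‖M (slice i ψ (e (c, b₀)))‖ ^ 2 := by
    intro c
    rw [L2.norm_sq]
    refine tsum_congr fun b => ?_
    rw [hs, hei]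
  have hle : ∀ c, ‖M (slice i ψ (e (c, b₀)))‖ ^ 2
      ≤ ‖M‖ ^ 2 * ∑' b, ‖ψ (e (c, b))‖ ^ 2 := by
    intro c
    rw [hn, ← mul_pow]
    exact pow_le_pow_left₀ (norm_nonneg _) (M.le_opNorm _) 2
  have hsum1 : Summable fun c => ‖M (slice i ψ (e (c, b₀)))‖ ^ 2 :=
    Summable.of_nonneg_of_le (fun c => by positivity) hle (hψ'.2.mul_left _)
  have key : Summable fun q => ‖M (slice i ψ (e q)) (e q i)‖ ^ 2 := by
    refine (summable_prod_of_nonneg (fun q => by positivity)).2 ⟨fun c => ?_, ?_⟩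
    · refine (L2.summable_sq (M (slice i ψ (e (c, b₀))))).congr fun b => ?_
      rw [hs c b, hei c b]
    · exact hsum1.congr fun c => (hm c).symm
  refine ⟨e.summable_iff.1 key, ?_⟩
  rw [← e.tsum_eq (fun a => ‖M (slice i ψ a) (a i)‖ ^ 2), key.tsum_prod, L2.norm_sq,
    ← e.tsum_eq (fun a => ‖ψ a‖ ^ 2), hψ.tsum_prod, ← tsum_mul_left]
  refine Summable.tsum_le_tsum (fun c => ?_) (hsum1.congr fun c => (hm c).symm)
    (hψ'.2.mul_left _)
  rw [hm]
  exact hle c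

/-- The operator `1 ⊗ … ⊗ M ⊗ … ⊗ 1` (with `M` in the place `i`). -/
noncomputable def slotOp (i : Fin n) (M : L2 (ι i) →L[ℂ] L2 (ι i)) :
    L2 (∀ j, ι j) →L[ℂ] L2 (∀ j, ι j) :=
  LinearMap.mkContinuous
    { toFun := fun ψ =>
        ⟨fun a => M (slice i ψ a) (a i), L2.mem_of_summable (slot_summable i M ψ).1⟩
      map_add' := fun ψ ψ' => by
        apply lp.ext
        funext a
        have h : slice i (ψ + ψ') a = slice i ψ a + slice i ψ' a := by
          apply lp.ext
          funext b
          simp [slice_apply]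
        change M (slice i (ψ + ψ') a) (a i) = M (slice i ψ a) (a i) + M (slice i ψ' a) (a i)
        rw [h, map_add]
        simp
      map_smul' := fun c ψ => by
        apply lp.ext
        funext a
        have h : slice i (c • ψ) a = c • slice i ψ a := by
          apply lp.ext
          funext b
          simp [slice_apply]
        change M (slice i (c • ψ) a) (a i) = c • M (slice i ψ a) (a i)
        rw [h, map_smul]
        simp }
    ‖M‖ (fun ψ => by
      refine (sq_le_sq₀ (norm_nonneg _) (by positivity)).1 ?_
      rw [L2.norm_sq, mul_pow]
      exact (slot_summable i M ψ).2)

/-- The operator `M₁ ⊗ … ⊗ Mₙ`, as the product of the (commuting) operators acting on the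
single tensor factors. -/
noncomputable def tensorOp (M : ∀ i, L2 (ι i) →L[ℂ] L2 (ι i)) :
    L2 (∀ j, ι j) →L[ℂ] L2 (∀ j, ι j) :=
  (List.ofFn fun i => slotOp i (M i)).prod

/-- `ψ = φ ⊗ χ` for some vectors `φ` of the parties in `S` and `χ` of the parties outside `S`. -/
def IsProductAcross (S : Finset (Fin n)) (ψ : L2 (∀ j, ι j)) : Prop :=
  ∃ (φ : L2 (∀ j : { j // j ∈ S }, ι j)) (χ : L2 (∀ j : { j // j ∉ S }, ι j)),
    ∀ a : ∀ j, ι j, ψ a = φ (fun j => a j) * χ (fun j => a j)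

/-- A biseparable pure state: a unit vector which is a product across some division of the
parties into two nonempty groups. -/
def IsBiseparableVector (ψ : L2 (∀ j, ι j)) : Prop :=
  ‖ψ‖ = 1 ∧ ∃ S : Finset (Fin n), S.Nonempty ∧ Sᶜ.Nonempty ∧ IsProductAcross S ψ

end Slot

/-- A measurement (POVM) with `k` outcomes on the Hilbert space `ℓ²(κ)`. -/
structure Measurement (κ : Type u) (k : ℕ) where
  effect : Fin k → (L2 κ →L[ℂ] L2 κ)
  isPositive : ∀ r, (effect r).IsPositive
  sum_eq_one : ∑ r, effect r = 1

open MeasureTheory in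
/-- Quantum biseparable correlations: `P(r|s) = tr(ρ M¹_{r₁|s₁} ⊗ … ⊗ Mⁿ_{rₙ|sₙ})`, where each
party `i` performs local measurements on its own Hilbert space (of any dimension) and the shared
state `ρ = ∫ |ψ_l⟩⟨ψ_l| dμ(l)` is a statistical mixture of biseparable pure states; the division
of the parties into two groups may vary with `l`. -/
def IsQuantumBiseparable {n m k : ℕ} (P : Correlation n m k) : Prop :=
  ∃ (ι : Fin n → Type u) (M : ∀ i, Fin m → Measurement (ι i) k)
    (Λ : Type v) (_ : MeasurableSpace Λ) (μ : Measure Λ) (_ : IsProbabilityMeasure μ)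
    (ψ : Λ → L2 (∀ i, ι i)),
    StronglyMeasurable ψ ∧ (∀ l, IsBiseparableVector (ψ l)) ∧
    ∀ s r, P s r =
      ∫ l, (inner ℂ (ψ l) (tensorOp (fun i => (M i (s i)).effect (r i)) (ψ l))).re ∂μ

/-- `ω_j = exp(iπ(2j+1)/m)`. -/
noncomputable def omegaRoot (m j : ℕ) : ℂ :=
  Complex.exp (Complex.I * ((Real.pi / m * (2 * j + 1) : ℝ) : ℂ))

/-- `η_j = gcd(2j+1, m)`. -/
def etaGcd (m j : ℕ) : ℕ := Nat.gcd (2 * j + 1) m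

/-- The cosecant. -/
noncomputable def csc (x : ℝ) : ℝ := 1 / Real.sin x

/-!
Write `E(s)` for the full correlator `∑_o (-1)^(∑ o) P(o | s)`. The Bell expression equals `(m ^
(n - 1) ∑ g - ∑_s g̃(∑ s) E(s)) / 2`, where `g̃(x) = (-1)^⌊x / m⌋ g([x]_m)` is the antiperiodic
extension of `g` (`bellExpr_eq`), so that an upper bound on `∑_s g̃(∑ s) E(s)` is needed. This sum
is linear in the state, hence it suffices to treat one biseparable unit vector `ψ`.

For two outcomes, `E(s)` is the expectation value of a tensor product of self-adjoint
contractions, and on a vector which is a product across `S` it splits as `E(s) = E_S(s) E_T(s)`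
with `T = Sᶜ`, both factors being real and in `[-1, 1]` (`inner_tensorOp_mul_of_product`). As `n ≥
3`, one of the groups, say `T`, has at least two members.

Expand `g̃` in the odd characters `x ↦ ω_j ^ (-x)` of `ℤ / 2m` (`fourier_inversion`), and fix all
inputs but those of one party in `S` and of two parties in `T`. The remaining sum over the input
of the party in `S` is `∑_x e_x ω_j ^ (-x)` with real `|e_x| ≤ 1`; after a rotation it is at most
a sum of `|cos|` over equally spaced angles, whence the factor `η_j csc(η_j π / 2m)`
(`norm_sum_mul_omegaRoot_le`). The sums over the inputs of the two parties in `T` are inner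
products `⟨V_j, W_j⟩` of Fourier transforms of families of vectors of norm at most `1`; by
Parseval and Cauchy-Schwarz their absolute values add up to at most `m²` over `j`
(`sum_norm_bipartite_fourier_le`). The two estimates are combined in `sum_product_correlator_le`.
-/

/-! ### Algebra of tensor products of operators -/

section TensorAlgebra

variable {n : ℕ} {ι : Fin n → Type u}

/-- `ψ = x₁ ⊗ … ⊗ xₙ`, expressed through the coordinates of `ψ`. -/
def IsPureTensor (ψ : L2 (∀ j, ι j)) (x : ∀ i, L2 (ι i)) : Prop :=
  ∀ a, ψ a = ∏ i, x i (a i)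

theorem slotOp_apply (i : Fin n) (M : L2 (ι i) →L[ℂ] L2 (ι i)) (ψ : L2 (∀ j, ι j))
    (a : ∀ j, ι j) : slotOp i M ψ a = M (slice i ψ a) (a i) := rfl

theorem IsPureTensor.slotOp {ψ : L2 (∀ j, ι j)} {x : ∀ i, L2 (ι i)} (h : IsPureTensor ψ x)
    (i : Fin n) (M : L2 (ι i) →L[ℂ] L2 (ι i)) :
    IsPureTensor (slotOp i M ψ) (Function.update x i (M (x i))) := by
  intro a
  have hs : slice i ψ a = (∏ j ∈ Finset.univ.erase i, x j (a j)) • x i := by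
    apply lp.ext
    funext b
    rw [slice_apply, h, ← Finset.mul_prod_erase _ _ (Finset.mem_univ i), mul_comm]
    simp only [Function.update_self, lp.coeFn_smul, Pi.smul_apply, smul_eq_mul]
    congr 1
    refine Finset.prod_congr rfl fun j hj => ?_
    rw [Function.update_of_ne (Finset.ne_of_mem_erase hj)]
  rw [slotOp_apply, hs, map_smul, ← Finset.mul_prod_erase _ _ (Finset.mem_univ i), mul_comm]
  simp only [Function.update_self, lp.coeFn_smul, Pi.smul_apply, smul_eq_mul]
  congr 1
  refine Finset.prod_congr rfl fun j hj => ?_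
  rw [Function.update_of_ne (Finset.ne_of_mem_erase hj)]

theorem IsPureTensor.tensorOp {ψ : L2 (∀ j, ι j)} {x : ∀ i, L2 (ι i)} (h : IsPureTensor ψ x)
    (M : ∀ i, L2 (ι i) →L[ℂ] L2 (ι i)) :
    IsPureTensor (tensorOp M ψ) (fun i => M i (x i)) := by
  classical
  have key : ∀ l : List (Fin n), l.Nodup →
      IsPureTensor ((l.map fun i => _root_.slotOp i (M i)).prod ψ)
        (fun i => if i ∈ l then M i (x i) else x i) := by
    intro l
    induction l with
    | nil => intro _; simpa using h
    | cons i l ih =>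
      intro hl
      rw [List.nodup_cons] at hl
      rw [List.map_cons, List.prod_cons, mul_apply_eq_comp]
      have := (ih hl.2).slotOp i (M i)
      convert this using 1
      funext j
      by_cases hj : j = i
      · subst hj; simp [hl.1]
      · simp [hj]
  have := key (List.finRange n) (List.nodup_finRange n)
  simpa [_root_.tensorOp, List.ofFn_eq_map] using this

theorem IsPureTensor.ext {ψ ψ' : L2 (∀ j, ι j)} {x : ∀ i, L2 (ι i)} (h : IsPureTensor ψ x)
    (h' : IsPureTensor ψ' x) : ψ = ψ' := by
  apply lp.ext
  funext a
  rw [h, h']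

theorem isPureTensor_single [∀ i, DecidableEq (ι i)] (a : ∀ j, ι j) :
    IsPureTensor (lp.single 2 a (1 : ℂ)) (fun i => lp.single 2 (a i) (1 : ℂ)) := by
  intro b
  by_cases hb : b = a
  · subst hb; simp
  · obtain ⟨i, hi⟩ := Function.ne_iff.1 hb
    rw [lp.single_apply_ne _ _ _ hb, Finset.prod_eq_zero (Finset.mem_univ i)]
    exact lp.single_apply_ne _ _ _ hi

theorem L2.clm_ext_single {κ : Type u} [DecidableEq κ] {F : Type*}
    [NormedAddCommGroup F] [NormedSpace ℂ F] {T T' : L2 κ →L[ℂ] F}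
    (h : ∀ a, T (lp.single 2 a (1 : ℂ)) = T' (lp.single 2 a (1 : ℂ))) :
    T = T' := by
  refine lp.ext_continuousLinearMap (by norm_num) fun a => ?_
  ext
  simpa using h a

/-- Pure tensors are total, so that operators are determined by their values on them. -/
theorem clm_ext_pureTensor {T T' : L2 (∀ j, ι j) →L[ℂ] L2 (∀ j, ι j)}
    (h : ∀ ψ x, IsPureTensor ψ x → T ψ = T' ψ) : T = T' := by
  classical
  exact L2.clm_ext_single fun a => h _ _ (isPureTensor_single a)

theorem tensorOp_mul (M N : ∀ i, L2 (ι i) →L[ℂ] L2 (ι i)) :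
    tensorOp M * tensorOp N = tensorOp fun i => M i * N i :=
  clm_ext_pureTensor fun _ _ h => ((h.tensorOp N).tensorOp M).ext (h.tensorOp fun i => M i * N i)

theorem tensorOp_one : tensorOp (fun i => (1 : L2 (ι i) →L[ℂ] L2 (ι i))) = 1 :=
  clm_ext_pureTensor fun _ _ h => (h.tensorOp _).ext h

theorem slotOp_one (i : Fin n) : slotOp i (1 : L2 (ι i) →L[ℂ] L2 (ι i)) = 1 :=
  clm_ext_pureTensor fun _ x h => by
    have h1 := h.slotOp i 1
    rw [one_apply_eq_self, Function.update_eq_self] at h1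
    exact h1.ext h

theorem L2.adjoint_single_apply {κ : Type u} [DecidableEq κ] (T : L2 κ →L[ℂ] L2 κ) (a b : κ) :
    (ContinuousLinearMap.adjoint T (lp.single 2 a (1 : ℂ))) b
      = star (T (lp.single 2 b (1 : ℂ)) a) := by
  have h1 := lp.inner_single_left (𝕜 := ℂ) b (1 : ℂ)
    (ContinuousLinearMap.adjoint T (lp.single 2 a (1 : ℂ)))
  have h2 := lp.inner_single_right (𝕜 := ℂ) a (1 : ℂ) (T (lp.single 2 b (1 : ℂ)))
  rw [ContinuousLinearMap.adjoint_inner_right] at h1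
  rw [h2] at h1
  simpa using h1.symm

theorem adjoint_tensorOp (M : ∀ i, L2 (ι i) →L[ℂ] L2 (ι i)) :
    ContinuousLinearMap.adjoint (tensorOp M)
      = tensorOp fun i => ContinuousLinearMap.adjoint (M i) := by
  classical
  refine L2.clm_ext_single fun a => ?_
  apply lp.ext
  funext b
  have hb := (isPureTensor_single b).tensorOp M a
  have ha := (isPureTensor_single a).tensorOp (fun i => ContinuousLinearMap.adjoint (M i)) b
  rw [L2.adjoint_single_apply]
  refine (congrArg star hb).trans (Eq.trans ?_ ha.symm)
  rw [star_prod]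
  exact Finset.prod_congr rfl fun i _ => (L2.adjoint_single_apply (M i) (a i) (b i)).symm

theorem isSelfAdjoint_tensorOp {M : ∀ i, L2 (ι i) →L[ℂ] L2 (ι i)}
    (h : ∀ i, IsSelfAdjoint (M i)) : IsSelfAdjoint (tensorOp M) := by
  rw [ContinuousLinearMap.isSelfAdjoint_iff', adjoint_tensorOp]
  congr 1
  funext i
  exact ContinuousLinearMap.isSelfAdjoint_iff'.1 (h i)

theorem norm_tensorOp_apply_le {M : ∀ i, L2 (ι i) →L[ℂ] L2 (ι i)} (h : ∀ i, ‖M i‖ ≤ 1)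
    (ψ : L2 (∀ j, ι j)) : ‖tensorOp M ψ‖ ≤ ‖ψ‖ := by
  have key : ∀ l : List (L2 (∀ j, ι j) →L[ℂ] L2 (∀ j, ι j)), (∀ T ∈ l, ‖T‖ ≤ 1) →
      ‖l.prod ψ‖ ≤ ‖ψ‖ := by
    intro l
    induction l with
    | nil => simp
    | cons T l ih =>
      intro hl
      rw [List.prod_cons, mul_apply_eq_comp]
      have h1 := T.le_of_opNorm_le (hl T (by simp)) (l.prod ψ)
      rw [one_mul] at h1
      exact h1.trans (ih fun T' hT' => hl T' (by simp [hT']))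
  refine key _ fun T hT => ?_
  obtain ⟨i, rfl⟩ := List.mem_ofFn.1 hT
  exact (LinearMap.mkContinuous_norm_le _ (norm_nonneg _) _).trans (h i)

/-- The linear map `M ↦ 1 ⊗ … ⊗ M ⊗ … ⊗ 1`. -/
noncomputable def slotOpLinear (i : Fin n) :
    (L2 (ι i) →L[ℂ] L2 (ι i)) →ₗ[ℂ] (L2 (∀ j, ι j) →L[ℂ] L2 (∀ j, ι j)) where
  toFun := slotOp i
  map_add' M N := by
    ext ψ a
    simp [slotOp_apply]
  map_smul' c M := by
    ext ψ a
    simp [slotOp_apply]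

/-- `(M₁, …, Mₙ) ↦ M₁ ⊗ … ⊗ Mₙ` as a multilinear map. -/
noncomputable def tensorOpMultilinear (ι : Fin n → Type u) :
    MultilinearMap ℂ (fun i => L2 (ι i) →L[ℂ] L2 (ι i)) (L2 (∀ j, ι j) →L[ℂ] L2 (∀ j, ι j)) :=
  (MultilinearMap.mkPiAlgebraFin ℂ n _).compLinearMap slotOpLinear

theorem tensorOpMultilinear_apply (M : ∀ i, L2 (ι i) →L[ℂ] L2 (ι i)) :
    tensorOpMultilinear ι M = tensorOp M := rfl

theorem tensorOp_sum_smul {k : ℕ} (c : Fin n → Fin k → ℂ)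
    (E : ∀ i, Fin k → (L2 (ι i) →L[ℂ] L2 (ι i))) :
    tensorOp (fun i => ∑ r, c i r • E i r)
      = ∑ o : Fin n → Fin k, (∏ i, c i (o i)) • tensorOp fun i => E i (o i) := by
  simp only [← tensorOpMultilinear_apply]
  rw [MultilinearMap.map_sum]
  refine Finset.sum_congr rfl fun o _ => ?_
  rw [MultilinearMap.map_smul_univ]

end TensorAlgebra

/-! ### Product vectors across a division of the parties -/

section Product

variable {n : ℕ} {ι : Fin n → Type u}

/-- A coordinate form of: `ψ = φ ⊗ χ` and `Ψ = φ' ⊗ χ` are products across `S` with a common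
factor `χ` of the parties outside `S`. Both sides are then `φ'(a) φ(b) χ(a) χ(b)`. For `Ψ = ψ`
it says that `ψ` is a product; no factors have to be chosen, and all vectors stay in the full space. -/
def SharesComplFactor (S : Finset (Fin n)) (ψ Ψ : L2 (∀ j, ι j)) : Prop :=
  ∀ a b, Ψ a * ψ b = Ψ (S.piecewise a b) * ψ (S.piecewise b a)

theorem IsProductAcross.sharesComplFactor {S : Finset (Fin n)} {ψ : L2 (∀ j, ι j)}
    (h : IsProductAcross S ψ) : SharesComplFactor S ψ ψ := by
  obtain ⟨φ, χ, h⟩ := h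
  have h1 : ∀ a b : ∀ j, ι j, (fun j : { j // j ∈ S } => S.piecewise a b j)
      = fun j : { j // j ∈ S } => a j := by
    intro a b; funext j; simp [j.2]
  have h2 : ∀ a b : ∀ j, ι j, (fun j : { j // j ∉ S } => S.piecewise a b j)
      = fun j : { j // j ∉ S } => b j := by
    intro a b; funext j; simp [j.2]
  intro a b
  rw [h, h, h, h, h1, h1, h2, h2]
  ring

theorem SharesComplFactor.self_compl {S : Finset (Fin n)} {ψ : L2 (∀ j, ι j)}
    (h : SharesComplFactor S ψ ψ) : SharesComplFactor Sᶜ ψ ψ := by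
  intro a b
  rw [Finset.piecewise_compl, Finset.piecewise_compl, h a b, mul_comm]

theorem SharesComplFactor.slotOp {S : Finset (Fin n)} {ψ Ψ : L2 (∀ j, ι j)}
    (h : SharesComplFactor S ψ Ψ) {i : Fin n} (hi : i ∈ S) (M : L2 (ι i) →L[ℂ] L2 (ι i)) :
    SharesComplFactor S ψ (slotOp i M Ψ) := by
  intro a b
  have hs : ψ b • slice i Ψ a = ψ (S.piecewise b a) • slice i Ψ (S.piecewise a b) := by
    apply lp.ext
    funext c
    simp only [lp.coeFn_smul, Pi.smul_apply, smul_eq_mul, slice_apply]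
    have e₁ : S.piecewise (Function.update a i c) b
        = Function.update (S.piecewise a b) i c := by
      funext j
      rcases eq_or_ne j i with rfl | hj <;> simp [Finset.piecewise, *]
    have e₂ : S.piecewise b (Function.update a i c) = S.piecewise b a :=
      Finset.piecewise_congr _ (fun _ _ => rfl) fun j hj =>
        Function.update_of_ne (by rintro rfl; exact hj hi) _ _
    rw [mul_comm, h, mul_comm, e₁, e₂]
  have h1 := congrArg (fun v => M v (a i)) hs
  simp only [map_smul, lp.coeFn_smul, Pi.smul_apply, smul_eq_mul] at h1
  rw [slotOp_apply, slotOp_apply, Finset.piecewise_eq_of_mem _ _ _ hi, mul_comm, h1, mul_comm]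

theorem SharesComplFactor.tensorOp {S : Finset (Fin n)} {ψ Ψ : L2 (∀ j, ι j)}
    (h : SharesComplFactor S ψ Ψ) {M : ∀ i, L2 (ι i) →L[ℂ] L2 (ι i)} (hM : ∀ i ∉ S, M i = 1) :
    SharesComplFactor S ψ (tensorOp M Ψ) := by
  have key : ∀ l : List (L2 (∀ j, ι j) →L[ℂ] L2 (∀ j, ι j)),
      (∀ T ∈ l, ∀ Φ, SharesComplFactor S ψ Φ → SharesComplFactor S ψ (T Φ)) →
      SharesComplFactor S ψ (l.prod Ψ) := by
    intro l
    induction l with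
    | nil => intro _; simpa using h
    | cons T l ih =>
      intro hl
      rw [List.prod_cons, mul_apply_eq_comp]
      exact hl T (by simp) _ (ih fun T' hT' => hl T' (by simp [hT']))
  refine key _ fun T hT Φ hΦ => ?_
  obtain ⟨i, rfl⟩ := List.mem_ofFn.1 hT
  by_cases hi : i ∈ S
  · exact hΦ.slotOp hi _
  · rw [hM i hi, slotOp_one]
    exact hΦ

/-- Exchanging the coordinates outside `S` of two index tuples. -/
def swapOutside (S : Finset (Fin n)) (ι : Fin n → Type u) :
    ((∀ j, ι j) × (∀ j, ι j)) ≃ ((∀ j, ι j) × (∀ j, ι j)) :=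
  Function.Involutive.toPerm (fun p => (S.piecewise p.1 p.2, S.piecewise p.2 p.1)) fun p => by
    refine Prod.ext (funext fun j => ?_) (funext fun j => ?_) <;>
      by_cases hj : j ∈ S <;> simp only [Finset.piecewise, hj, if_true, if_false]

/-- For a product vector `ψ = φ ⊗ χ`, and `Ψ₁ = φ' ⊗ χ`, `Ψ₂ = φ ⊗ χ'`, the inner product of
`Ψ₁` and `Ψ₂` factorizes: `⟨φ', φ⟩⟨χ, χ'⟩ ‖φ‖² ‖χ‖²` is obtained on both sides. -/
theorem SharesComplFactor.inner_mul_inner {S : Finset (Fin n)} {ψ Ψ₁ Ψ₂ : L2 (∀ j, ι j)}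
    (h₁ : SharesComplFactor S ψ Ψ₁) (h₂ : SharesComplFactor Sᶜ ψ Ψ₂) :
    inner ℂ Ψ₁ Ψ₂ * inner ℂ ψ ψ = inner ℂ Ψ₁ ψ * inner ℂ ψ Ψ₂ := by
  have hin : ∀ f g : L2 (∀ j, ι j), inner ℂ f g = ∑' a, g a * starRingEnd ℂ (f a) :=
    fun f g => lp.inner_eq_tsum f g
  have hs : ∀ f g : L2 (∀ j, ι j), Summable fun a => ‖g a * starRingEnd ℂ (f a)‖ :=
    fun f g => (lp.summable_inner (𝕜 := ℂ) f g).norm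
  rw [hin, hin, hin, hin, tsum_mul_tsum_of_summable_norm (hs _ _) (hs _ _),
    tsum_mul_tsum_of_summable_norm (hs _ _) (hs _ _),
    ← (swapOutside S ι).tsum_eq fun p =>
      ψ p.1 * starRingEnd ℂ (Ψ₁ p.1) * (Ψ₂ p.2 * starRingEnd ℂ (ψ p.2))]
  refine tsum_congr fun p => ?_
  have e₁ := h₁ p.1 p.2
  have e₂ := h₂ p.1 p.2
  rw [Finset.piecewise_compl, Finset.piecewise_compl] at e₂
  change _ = ψ (S.piecewise p.1 p.2) * starRingEnd ℂ (Ψ₁ (S.piecewise p.1 p.2))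
    * (Ψ₂ (S.piecewise p.2 p.1) * starRingEnd ℂ (ψ (S.piecewise p.2 p.1)))
  generalize Ψ₁ p.1 = x₁ at e₁ ⊢
  generalize ψ p.2 = x₂ at e₁ e₂ ⊢
  generalize Ψ₁ (S.piecewise p.1 p.2) = x₃ at e₁ ⊢
  generalize ψ (S.piecewise p.2 p.1) = x₄ at e₁ e₂ ⊢
  generalize Ψ₂ p.1 = y₁ at e₂ ⊢
  generalize Ψ₂ (S.piecewise p.2 p.1) = y₃ at e₂ ⊢
  generalize ψ (S.piecewise p.1 p.2) = y₄ at e₂ ⊢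
  have e₁' := congrArg (starRingEnd ℂ) e₁
  simp only [map_mul] at e₁'
  linear_combination (y₁ * x₂) * e₁' + (starRingEnd ℂ x₃ * starRingEnd ℂ x₄) * e₂

/-- Expectation values of local operators factorize on biseparable vectors. -/
theorem inner_tensorOp_mul_of_product {S : Finset (Fin n)} {ψ : L2 (∀ j, ι j)}
    (h : SharesComplFactor S ψ ψ) (hψ : ‖ψ‖ = 1) {M N : ∀ i, L2 (ι i) →L[ℂ] L2 (ι i)}
    (hM : ∀ i ∉ S, M i = 1) (hN : ∀ i ∈ S, N i = 1) (hM' : ∀ i, IsSelfAdjoint (M i)) :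
    inner ℂ ψ (tensorOp M (tensorOp N ψ))
      = inner ℂ ψ (tensorOp M ψ) * inner ℂ ψ (tensorOp N ψ) := by
  have hsa : (tensorOp M : _ →L[ℂ] _).adjoint = tensorOp M :=
    ContinuousLinearMap.isSelfAdjoint_iff'.1 (isSelfAdjoint_tensorOp hM')
  have h₁ := h.tensorOp hM
  have h₂ := h.self_compl.tensorOp (M := N) fun i hi => hN i (by simpa using hi)
  have key := h₁.inner_mul_inner h₂
  have hone : inner ℂ ψ ψ = (1 : ℂ) := by simp [inner_self_eq_norm_sq_to_K, hψ]
  rw [hone, mul_one] at key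
  rw [← ContinuousLinearMap.adjoint_inner_left (tensorOp M) (tensorOp N ψ) ψ,
    ← ContinuousLinearMap.adjoint_inner_left (tensorOp M) ψ ψ, hsa, key]

end Product

/-! ### The bound on `|∑ e_s ω_j ^ s|` for real weights in `[-1, 1]` -/

section Cosine

open Finset

theorem sum_range_mul_of_periodic {F : ℕ → ℝ} {M : ℕ} (hF : Function.Periodic F M) (e : ℕ) :
    ∑ s ∈ range (e * M), F s = e * ∑ s ∈ range M, F s := by
  induction e with
  | zero => simp
  | succ e ih =>
    rw [Nat.succ_mul, sum_range_add, ih]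
    have : ∀ s, F (e * M + s) = F s := fun s => by
      rw [add_comm]; exact hF.nat_mul e s
    simp only [this]
    push_cast
    ring

theorem sum_range_mul_left_of_coprime {F : ℕ → ℝ} {M k : ℕ} (hF : Function.Periodic F M)
    (hk : Nat.Coprime k M) : ∑ s ∈ range M, F (k * s) = ∑ s ∈ range M, F s := by
  rcases Nat.eq_zero_or_pos M with rfl | hM
  · simp
  have hinj : Set.InjOn (fun s => k * s % M) (range M) := by
    intro s hs t ht hst
    have h1 : k * s ≡ k * t [MOD M] := hst
    have h2 := Nat.ModEq.cancel_left_of_coprime (Nat.coprime_comm.1 hk) h1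
    simp only [coe_range, Set.mem_Iio] at hs ht
    rwa [Nat.ModEq, Nat.mod_eq_of_lt hs, Nat.mod_eq_of_lt ht] at h2
  have himg : (range M).image (fun s => k * s % M) = range M := by
    refine eq_of_subset_of_card_le (image_subset_iff.2 fun s _ => mem_range.2 (Nat.mod_lt _ hM)) ?_
    rw [card_image_of_injOn hinj]
  calc ∑ s ∈ range M, F (k * s) = ∑ s ∈ range M, F (k * s % M) :=
        sum_congr rfl fun s _ => (hF.map_mod_nat _).symm
    _ = ∑ s ∈ (range M).image (fun s => k * s % M), F s := (sum_image hinj).symm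
    _ = _ := by rw [himg]

/-- Multiplication by `k` maps `ℤ/m` onto the multiples of `gcd(k, m)`, each being hit `gcd(k, m)`
times. -/
theorem sum_range_mul_eq_gcd {F : ℕ → ℝ} {m : ℕ} (hm : 0 < m) (hF : Function.Periodic F m)
    (k : ℕ) : ∑ s ∈ range m, F (k * s)
      = Nat.gcd k m * ∑ t ∈ range (m / Nat.gcd k m), F (Nat.gcd k m * t) := by
  set d := Nat.gcd k m with hd
  have hd0 : 0 < d := Nat.gcd_pos_of_pos_right _ hm
  obtain ⟨k', hk'⟩ : d ∣ k := Nat.gcd_dvd_left _ _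
  have hdm : d * (m / d) = m := Nat.mul_div_cancel' (Nat.gcd_dvd_right k m)
  have hper : Function.Periodic (fun t => F (d * t)) (m / d) := by
    intro t
    change F (d * (t + m / d)) = F (d * t)
    rw [mul_add, hdm]
    exact hF _
  have hper' : Function.Periodic (fun t => F (d * (k' * t))) (m / d) := by
    intro t
    have := hper.nat_mul k' (k' * t)
    simp only [Nat.cast_id] at this
    change F (d * (k' * (t + m / d))) = F (d * (k' * t))
    rw [mul_add]
    exact this
  have hcop : Nat.Coprime k' (m / d) := by
    have := Nat.coprime_div_gcd_div_gcd (m := k) (n := m) hd0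
    rwa [← hd, Nat.div_eq_of_eq_mul_right hd0 hk'] at this
  have h1 := sum_range_mul_of_periodic hper' d
  rw [hdm, sum_range_mul_left_of_coprime (F := fun t => F (d * t)) hper hcop] at h1
  rw [← h1]
  refine sum_congr rfl fun s _ => ?_
  rw [hk', mul_assoc]

/-- `2 sin δ cos(x + 2δt)` telescopes to a difference of sines. -/
theorem sin_mul_sum_cos (δ x : ℝ) (M : ℕ) :
    2 * Real.sin δ * ∑ t ∈ range M, Real.cos (x + 2 * δ * t)
      = Real.sin (x + 2 * δ * M - δ) - Real.sin (x - δ) := by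
  have h : ∀ t : ℕ, 2 * Real.sin δ * Real.cos (x + 2 * δ * t)
      = Real.sin (x + 2 * δ * ((t + 1 : ℕ) : ℝ) - δ) - Real.sin (x + 2 * δ * t - δ) := by
    intro t
    have e1 : x + 2 * δ * ((t + 1 : ℕ) : ℝ) - δ = (x + 2 * δ * t) + δ := by push_cast; ring
    rw [e1, Real.sin_add, Real.sin_sub]
    ring
  rw [mul_sum, sum_congr rfl fun t _ => h t,
    sum_range_sub fun t : ℕ => Real.sin (x + 2 * δ * t - δ)]
  simp

theorem periodic_abs_cos : Function.Periodic (fun x => |Real.cos x|) Real.pi := fun x => by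
  simp

theorem sum_abs_cos_le (M : ℕ) (hM : 0 < M) (x : ℝ) :
    ∑ t ∈ range M, |Real.cos (x + Real.pi / M * t)| ≤ 1 / Real.sin (Real.pi / (2 * M)) := by
  have hM' : (0 : ℝ) < M := by exact_mod_cast hM
  have hM1 : (1 : ℝ) ≤ M := by exact_mod_cast hM
  set F : ℝ → ℝ := fun x => ∑ t ∈ range M, |Real.cos (x + Real.pi / M * t)| with hF
  have hper : Function.Periodic F (Real.pi / M) := by
    intro x
    have h1 : ∀ t : ℕ, x + Real.pi / M + Real.pi / M * t
        = x + Real.pi / M * ((t + 1 : ℕ) : ℝ) := fun t => by push_cast; ring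
    simp only [hF, h1]
    have h2 := sum_range_succ (fun t : ℕ => |Real.cos (x + Real.pi / M * t)|) M
    rw [sum_range_succ'] at h2
    have h3 : |Real.cos (x + Real.pi / M * M)| = |Real.cos (x + Real.pi / M * (0 : ℕ))| := by
      rw [div_mul_cancel₀ _ hM'.ne', Nat.cast_zero, mul_zero, add_zero]
      exact periodic_abs_cos x
    rw [h3] at h2
    exact add_right_cancel h2
  have hδ : 0 < Real.pi / (2 * M) := by positivity
  have hδ' : Real.pi / (2 * M) ≤ Real.pi / 2 := by
    gcongr
    linarith
  have hsin : 0 < Real.sin (Real.pi / (2 * M)) :=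
    Real.sin_pos_of_pos_of_lt_pi hδ (by linarith [Real.pi_pos])
  -- A shift by a multiple of `π / M` puts all the angles where the cosine is nonnegative.
  obtain ⟨y, hy, hxy⟩ := hper.exists_mem_Ico (by positivity) x (-(Real.pi / 2))
  change F x ≤ _
  rw [hxy, le_div_iff₀ hsin]
  have hcos : F y = ∑ t ∈ range M, Real.cos (y + 2 * (Real.pi / (2 * M)) * t) := by
    refine sum_congr rfl fun t ht => ?_
    have ht' : ((t : ℝ) + 1) ≤ M := by exact_mod_cast mem_range.1 ht
    have h2 : Real.pi / M * ((t : ℝ) + 1) ≤ Real.pi := by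
      calc Real.pi / M * ((t : ℝ) + 1) ≤ Real.pi / M * M := by gcongr
        _ = Real.pi := div_mul_cancel₀ _ hM'.ne'
    have h3 : 0 ≤ Real.pi / M * t := by positivity
    have h4 : 2 * (Real.pi / (2 * M)) * t = Real.pi / M * t := by field_simp
    rw [h4, abs_of_nonneg]
    have := hy.1
    have := hy.2
    exact Real.cos_nonneg_of_neg_pi_div_two_le_of_le (by linarith) (by linarith)
  have h5 := sin_mul_sum_cos (Real.pi / (2 * M)) y M
  rw [← hcos] at h5
  have := Real.sin_le_one (y + 2 * (Real.pi / (2 * M)) * M - Real.pi / (2 * M))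
  have := Real.neg_one_le_sin (y - Real.pi / (2 * M))
  linarith

theorem sum_abs_cos_mul_le {m : ℕ} (hm : 0 < m) (k : ℕ) (x : ℝ) :
    ∑ s ∈ range m, |Real.cos (x + Real.pi / m * (k * s))|
      ≤ Nat.gcd k m * csc (Nat.gcd k m * Real.pi / (2 * m)) := by
  have hm' : (0 : ℝ) < m := by exact_mod_cast hm
  set F : ℕ → ℝ := fun t => |Real.cos (x + Real.pi / m * t)| with hF
  have hper : Function.Periodic F m := by
    intro t
    have h : x + Real.pi / m * ((t + m : ℕ) : ℝ) = x + Real.pi / m * t + Real.pi := by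
      push_cast; field_simp; ring
    simp only [hF, h]
    exact periodic_abs_cos _
  have h1 := sum_range_mul_eq_gcd hm hper k
  set d := Nat.gcd k m with hd
  have hd0 : 0 < d := Nat.gcd_pos_of_pos_right _ hm
  have hd' : (0 : ℝ) < d := by exact_mod_cast hd0
  have hdm : d * (m / d) = m := Nat.mul_div_cancel' (Nat.gcd_dvd_right k m)
  have hM : 0 < m / d := Nat.pos_of_ne_zero fun h => by rw [h] at hdm; omega
  have hM' : (0 : ℝ) < (m / d : ℕ) := by exact_mod_cast hM
  have hdm' : (d : ℝ) * (m / d : ℕ) = m := by exact_mod_cast hdm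
  have h2 := sum_abs_cos_le (m / d) hM x
  have h3 : Real.pi / (2 * ((m / d : ℕ) : ℝ)) = d * Real.pi / (2 * m) := by
    rw [← hdm']; field_simp
  have h4 : ∀ t : ℕ, F (d * t) = |Real.cos (x + Real.pi / ((m / d : ℕ) : ℝ) * t)| := by
    intro t
    simp only [hF]
    congr 3
    push_cast
    rw [← hdm']
    field_simp
  have h5 : ∑ s ∈ range m, |Real.cos (x + Real.pi / m * (k * s))|
      = ∑ s ∈ range m, F (k * s) := sum_congr rfl fun s _ => by simp [hF]
  rw [h5, h1]
  simp only [h4]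
  rw [csc, ← h3]
  gcongr

theorem norm_omegaRoot (m j : ℕ) : ‖omegaRoot m j‖ = 1 := by
  rw [omegaRoot, mul_comm, Complex.norm_exp_ofReal_mul_I]

theorem omegaRoot_ne_zero (m j : ℕ) : omegaRoot m j ≠ 0 := Complex.exp_ne_zero _

theorem conj_omegaRoot (m j : ℕ) : starRingEnd ℂ (omegaRoot m j) = (omegaRoot m j)⁻¹ := by
  rw [Complex.inv_def, Complex.normSq_eq_norm_sq, norm_omegaRoot]
  simp

theorem etaGcd_mul_csc_nonneg {m : ℕ} (hm : 0 < m) (j : ℕ) :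
    0 ≤ (etaGcd m j : ℝ) * csc ((etaGcd m j : ℝ) * Real.pi / (2 * m)) := by
  refine (sum_nonneg fun s _ => ?_).trans (sum_abs_cos_mul_le hm (2 * j + 1) 0)
  exact abs_nonneg _

/-- A single party, whose correlator takes values in `[-1, 1]`, contributes at most
`η_j csc(η_j π / 2m)` to each Fourier mode. -/
theorem norm_sum_mul_omegaRoot_le {m : ℕ} (hm : 0 < m) (j : ℕ) (e : Fin m → ℝ)
    (he : ∀ s, |e s| ≤ 1) :
    ‖∑ s : Fin m, (e s : ℂ) * (omegaRoot m j)⁻¹ ^ (s : ℕ)‖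
      ≤ (etaGcd m j : ℝ) * csc ((etaGcd m j : ℝ) * Real.pi / (2 * m)) := by
  set z := ∑ s : Fin m, (e s : ℂ) * (omegaRoot m j)⁻¹ ^ (s : ℕ) with hz
  -- Rotating the sum by the phase of `z` makes it real; each term is then a cosine.
  have hrot : ‖z‖ = (Complex.exp (((-z.arg : ℝ) : ℂ) * Complex.I) * z).re := by
    conv_rhs => rw [← Complex.norm_mul_exp_arg_mul_I z]
    rw [mul_left_comm, ← Complex.exp_add]
    simp
  have hterm : ∀ s : ℕ, (Complex.exp (((-z.arg : ℝ) : ℂ) * Complex.I)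
      * (omegaRoot m j)⁻¹ ^ s).re = Real.cos (z.arg + Real.pi / m * ((2 * j + 1 : ℕ) * s)) := by
    intro s
    rw [omegaRoot, ← Complex.exp_neg, ← Complex.exp_nat_mul, ← Complex.exp_add,
      ← Real.cos_neg (z.arg + _), ← Complex.exp_ofReal_mul_I_re]
    congr 2
    push_cast
    ring
  rw [hrot, hz, mul_sum, Complex.re_sum]
  calc ∑ s : Fin m, (Complex.exp (((-z.arg : ℝ) : ℂ) * Complex.I)
        * ((e s : ℂ) * (omegaRoot m j)⁻¹ ^ (s : ℕ))).re
      ≤ ∑ s : Fin m, |Real.cos (z.arg + Real.pi / m * ((2 * j + 1 : ℕ) * (s : ℕ)))| := by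
        refine sum_le_sum fun s _ => ?_
        rw [mul_left_comm, Complex.re_ofReal_mul, hterm]
        refine (le_abs_self _).trans ?_
        rw [abs_mul]
        exact mul_le_of_le_one_left (abs_nonneg _) (he s)
    _ = ∑ s ∈ range m, |Real.cos (z.arg + Real.pi / m * ((2 * j + 1 : ℕ) * s))| :=
        Fin.sum_univ_eq_sum_range
          (fun s : ℕ => |Real.cos (z.arg + Real.pi / m * ((2 * j + 1 : ℕ) * s))|) m
    _ ≤ _ := sum_abs_cos_mul_le hm (2 * j + 1) z.arg

end Cosine

/-! ### Antiperiodic Fourier analysis -/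

section Fourier

open Finset

theorem omegaRoot_pow_self {m : ℕ} (hm : 0 < m) (j : ℕ) : omegaRoot m j ^ m = -1 := by
  have hm' : (m : ℂ) ≠ 0 := by exact_mod_cast hm.ne'
  rw [omegaRoot, ← Complex.exp_nat_mul, ← Complex.exp_pi_mul_I]
  have : (m : ℂ) * (Complex.I * ((Real.pi / m * (2 * j + 1) : ℝ) : ℂ))
      = Real.pi * Complex.I + j * (2 * Real.pi * Complex.I) := by
    push_cast
    field_simp
    ring
  rw [this, Complex.exp_add, Complex.exp_nat_mul_two_pi_mul_I, mul_one]

theorem sum_omegaRoot_zpow_eq_zero {m : ℕ} (d : ℤ) (hd : ¬ (m : ℤ) ∣ d) :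
    ∑ j : Fin m, omegaRoot m j ^ d = 0 := by
  rcases Nat.eq_zero_or_pos m with rfl | hm
  · simp
  have hm' : (m : ℂ) ≠ 0 := by exact_mod_cast hm.ne'
  set ζ := Complex.exp (2 * Real.pi * Complex.I / m) with hζ
  have hprim : IsPrimitiveRoot ζ m := Complex.isPrimitiveRoot_exp m hm.ne'
  have h1 : ∀ j : ℕ, omegaRoot m j ^ d = omegaRoot m 0 ^ d * (ζ ^ d) ^ j := by
    intro j
    have : omegaRoot m j = omegaRoot m 0 * ζ ^ j := by
      rw [omegaRoot, omegaRoot, hζ, ← Complex.exp_nat_mul, ← Complex.exp_add]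
      congr 1
      push_cast
      field_simp
      ring
    rw [this, mul_zpow, ← zpow_natCast, ← zpow_natCast, ← zpow_mul, ← zpow_mul, mul_comm d]
  have h2 : ζ ^ d ≠ 1 := fun h => hd ((hprim.zpow_eq_one_iff_dvd d).1 h)
  have h3 : (ζ ^ d) ^ m = 1 := by
    rw [← zpow_natCast, ← zpow_mul, mul_comm, zpow_mul, zpow_natCast, hprim.pow_eq_one, one_zpow]
  rw [Fin.sum_univ_eq_sum_range (fun j => omegaRoot m j ^ d) m]
  rw [sum_congr rfl fun j _ => h1 j, ← mul_sum, geom_sum_eq h2, h3]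
  simp

/-- Fourier inversion for the antiperiodic extension `x ↦ (-1)^⌊x / m⌋ g([x]_m)` of `g`. -/
theorem fourier_inversion {m : ℕ} [NeZero m] (g : Fin m → ℝ) (x : ℕ) :
    ∑ j : Fin m, (∑ s : Fin m, (g s : ℂ) * omegaRoot m j ^ (s : ℕ)) * (omegaRoot m j)⁻¹ ^ x
      = m * ((-1) ^ (x / m) * g (residue m x)) := by
  have hm : 0 < m := Nat.pos_of_ne_zero (NeZero.ne m)
  have hres : ((residue m x : Fin m) : ℕ) = x % m := by
    simp only [residue]; omega
  simp only [sum_mul]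
  rw [sum_comm, sum_eq_single (residue m x)]
  · have h : ∀ j : ℕ, (g (residue m x) : ℂ) * omegaRoot m j ^ ((residue m x : Fin m) : ℕ)
        * (omegaRoot m j)⁻¹ ^ x = (-1) ^ (x / m) * g (residue m x) := by
      intro j
      have h0 := omegaRoot_ne_zero m j
      have h1 : omegaRoot m j ^ x = (-1) ^ (x / m) * omegaRoot m j ^ (x % m) := by
        conv_lhs => rw [← Nat.div_add_mod x m, pow_add, pow_mul, omegaRoot_pow_self hm]
      rw [hres, inv_pow, h1, mul_inv]
      have h2 : ((-1 : ℂ) ^ (x / m))⁻¹ = (-1) ^ (x / m) := by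
        rw [← inv_pow]; norm_num
      rw [h2]
      field_simp
    simp only [h, sum_const, card_univ, Fintype.card_fin, nsmul_eq_mul]
  · intro s _ hs
    have h : ∀ j : ℕ, (g s : ℂ) * omegaRoot m j ^ (s : ℕ) * (omegaRoot m j)⁻¹ ^ x
        = g s * omegaRoot m j ^ ((s : ℤ) - (x : ℤ)) := by
      intro j
      rw [zpow_sub₀ (omegaRoot_ne_zero m j), zpow_natCast, zpow_natCast, inv_pow, mul_assoc,
        div_eq_mul_inv]
    simp only [h]
    rw [← mul_sum, sum_omegaRoot_zpow_eq_zero, mul_zero]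
    intro hdvd
    apply hs
    apply Fin.ext
    rw [hres]
    have h1 := (Int.emod_emod_of_dvd (x : ℤ) (dvd_refl (m : ℤ)))
    have h2 : (s : ℤ) % m = (x : ℤ) % m := Int.emod_eq_emod_iff_emod_sub_eq_zero.2
      (Int.emod_eq_zero_of_dvd hdvd)
    have h3 : (s : ℕ) % m = x % m := by exact_mod_cast h2
    rwa [Nat.mod_eq_of_lt s.2] at h3
  · exact fun h => absurd (mem_univ _) h

/-- Parseval's inequality for vector-valued functions on `{0, …, m - 1}`, with respect to
orthogonal characters `y ↦ ζ_j ^ y`. -/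
theorem sum_norm_sq_fourier_le {m : ℕ} {E : Type*} [NormedAddCommGroup E] [InnerProductSpace ℂ E]
    (ζ : Fin m → ℂ) (hζ : ∀ j, ‖ζ j‖ = 1) (horth : ∀ d : ℤ, ¬ (m : ℤ) ∣ d → ∑ j, ζ j ^ d = 0)
    (v : Fin m → E) (hv : ∀ y, ‖v y‖ ≤ 1) :
    ∑ j : Fin m, ‖∑ y : Fin m, ζ j ^ (y : ℕ) • v y‖ ^ 2 ≤ (m : ℝ) ^ 2 := by
  have hζ0 : ∀ j, ζ j ≠ 0 := fun j => norm_ne_zero_iff.1 (by rw [hζ]; exact one_ne_zero)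
  have h : ∀ j y y' : Fin m, inner ℂ (ζ j ^ (y : ℕ) • v y) (ζ j ^ (y' : ℕ) • v y')
      = ζ j ^ ((y' : ℤ) - (y : ℤ)) * inner ℂ (v y) (v y') := by
    intro j y y'
    have hconj : starRingEnd ℂ (ζ j) = (ζ j)⁻¹ := by
      rw [Complex.inv_def, Complex.normSq_eq_norm_sq, hζ]
      simp
    rw [inner_smul_left, inner_smul_right, map_pow, hconj, zpow_sub₀ (hζ0 j), zpow_natCast,
      zpow_natCast, inv_pow, div_eq_mul_inv]
    ring
  have key : ∑ j : Fin m, inner ℂ (∑ y : Fin m, ζ j ^ (y : ℕ) • v y)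
      (∑ y : Fin m, ζ j ^ (y : ℕ) • v y) = (m : ℂ) * ∑ y, inner ℂ (v y) (v y) := by
    simp only [sum_inner, inner_sum, h]
    rw [sum_comm, mul_sum]
    refine sum_congr rfl fun y _ => ?_
    rw [sum_comm, sum_eq_single y]
    · simp
    · intro y' _ hy'
      rw [← sum_mul, horth, zero_mul]
      intro hdvd
      apply hy'
      apply Fin.ext
      have h2 : (y : ℤ) % m = (y' : ℤ) % m := Int.emod_eq_emod_iff_emod_sub_eq_zero.2
        (Int.emod_eq_zero_of_dvd hdvd)
      have h3 : (y : ℕ) % m = (y' : ℕ) % m := by exact_mod_cast h2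
      rw [Nat.mod_eq_of_lt y.2, Nat.mod_eq_of_lt y'.2] at h3
      exact h3.symm
    · simp
  simp only [inner_self_eq_norm_sq_to_K] at key
  have key' : ∑ j : Fin m, ‖∑ y : Fin m, ζ j ^ (y : ℕ) • v y‖ ^ 2 = m * ∑ y, ‖v y‖ ^ 2 := by
    apply Complex.ofReal_injective
    push_cast
    exact key
  rw [key', sq]
  gcongr
  calc ∑ y, ‖v y‖ ^ 2 ≤ ∑ _y : Fin m, (1 : ℝ) :=
        sum_le_sum fun y _ => pow_le_one₀ (norm_nonneg _) (hv y)
    _ = m := by simp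

/-- The Fourier modes of a two-party quantum correlator `(y, z) ↦ ⟨ψ, B_y C_z ψ⟩` have total
weight at most `m²`, by Parseval's inequality for the two families of vectors `B_y† ψ`, `C_z ψ`. -/
theorem sum_norm_bipartite_fourier_le {m : ℕ} {H : Type*} [NormedAddCommGroup H]
    [InnerProductSpace ℂ H] [CompleteSpace H] (ψ : H) (B C : Fin m → (H →L[ℂ] H))
    (hB : ∀ y, ‖ContinuousLinearMap.adjoint (B y) ψ‖ ≤ 1) (hC : ∀ z, ‖C z ψ‖ ≤ 1) :
    ∑ j : Fin m, ‖∑ y : Fin m, ∑ z : Fin m,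
      (omegaRoot m j)⁻¹ ^ (y : ℕ) * (omegaRoot m j)⁻¹ ^ (z : ℕ) * inner ℂ ψ (B y (C z ψ))‖
      ≤ (m : ℝ) ^ 2 := by
  set V : Fin m → H := fun j =>
    ∑ y : Fin m, omegaRoot m j ^ (y : ℕ) • ContinuousLinearMap.adjoint (B y) ψ with hV
  set W : Fin m → H := fun j => ∑ z : Fin m, (omegaRoot m j)⁻¹ ^ (z : ℕ) • C z ψ with hW
  have h : ∀ j : Fin m, ∑ y : Fin m, ∑ z : Fin m, (omegaRoot m j)⁻¹ ^ (y : ℕ)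
      * (omegaRoot m j)⁻¹ ^ (z : ℕ) * inner ℂ ψ (B y (C z ψ)) = inner ℂ (V j) (W j) := by
    intro j
    simp only [hV, hW, sum_inner, inner_sum]
    rw [sum_comm]
    refine sum_congr rfl fun z _ => sum_congr rfl fun y _ => ?_
    rw [inner_smul_left, inner_smul_right, map_pow, conj_omegaRoot,
      ContinuousLinearMap.adjoint_inner_left]
    ring
  have hV2 : ∑ j, ‖V j‖ ^ 2 ≤ (m : ℝ) ^ 2 :=
    sum_norm_sq_fourier_le _ (fun j => norm_omegaRoot m j) sum_omegaRoot_zpow_eq_zero _ hB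
  have hW2 : ∑ j, ‖W j‖ ^ 2 ≤ (m : ℝ) ^ 2 := by
    refine sum_norm_sq_fourier_le (fun j : Fin m => (omegaRoot m j)⁻¹)
      (fun j => by rw [norm_inv, norm_omegaRoot, inv_one]) (fun d hd => ?_) _ hC
    simp only [inv_zpow']
    exact sum_omegaRoot_zpow_eq_zero (-d) (by rwa [dvd_neg])
  calc _ ≤ ∑ j, (‖V j‖ ^ 2 + ‖W j‖ ^ 2) / 2 := by
        refine sum_le_sum fun j _ => ?_
        rw [h]
        refine (norm_inner_le_norm _ _).trans ?_
        nlinarith [sq_nonneg (‖V j‖ - ‖W j‖)]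
    _ ≤ (m : ℝ) ^ 2 := by
        rw [← sum_div, sum_add_distrib]
        linarith

end Fourier

/-! ### Averaging over the inputs of single parties -/

section Averaging

open Finset

theorem sum_sum_update {n m : ℕ} {R : Type*} [CommSemiring R] (i : Fin n)
    (h : (Fin n → Fin m) → R) :
    ∑ s : Fin n → Fin m, ∑ x : Fin m, h (Function.update s i x) = m * ∑ s, h s := by
  let e : ((Fin n → Fin m) × Fin m) ≃ ((Fin n → Fin m) × Fin m) :=
    Function.Involutive.toPerm (fun p => (Function.update p.1 i p.2, p.1 i)) fun p => by
      simp
  rw [← Fintype.sum_prod_type' (fun s x => h (Function.update s i x))]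
  refine (e.sum_comp (fun p : (Fin n → Fin m) × Fin m => h p.1)).trans ?_
  rw [Fintype.sum_prod_type]
  simp [mul_sum]

theorem total_update {n d : ℕ} (s : Fin n → Fin d) (i : Fin n) (x : Fin d) :
    total (Function.update s i x) + s i = total s + x := by
  rw [total, total, ← add_sum_erase _ _ (mem_univ i),
    ← add_sum_erase univ (fun j => (s j : ℕ)) (mem_univ i), Function.update_self]
  have : ∑ j ∈ univ.erase i, (Function.update s i x j : ℕ) = ∑ j ∈ univ.erase i, (s j : ℕ) :=
    sum_congr rfl fun j hj => by rw [Function.update_of_ne (ne_of_mem_erase hj)]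
  rw [this]
  ring

theorem residue_natCast_val {m : ℕ} [NeZero m] (x : ℕ) : ((residue m x : Fin m) : ℕ) = x % m := by
  simp only [residue]
  omega

/-- The total input is uniformly distributed modulo `m`. -/
theorem sum_residue_total {n m : ℕ} [NeZero m] (hn : 0 < n) (g : Fin m → ℝ) :
    ∑ s : Fin n → Fin m, g (residue m (total s)) = (m : ℝ) ^ (n - 1) * ∑ t, g t := by
  have hm : (m : ℝ) ≠ 0 := by exact_mod_cast NeZero.ne m
  have h1 := sum_sum_update (R := ℝ) (m := m) (⟨0, hn⟩ : Fin n) fun s => g (residue m (total s))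
  have h2 : ∀ s : Fin n → Fin m,
      ∑ x : Fin m, g (residue m (total (Function.update s ⟨0, hn⟩ x))) = ∑ t, g t := by
    intro s
    have hinj : Function.Injective fun x : Fin m =>
        residue m (total (Function.update s ⟨0, hn⟩ x)) := by
      intro x y hxy
      have h3 := congrArg Fin.val hxy
      simp only [residue_natCast_val] at h3
      have hx := total_update s ⟨0, hn⟩ x
      have hy := total_update s ⟨0, hn⟩ y
      have h4 : total s + (x : ℕ) ≡ total s + (y : ℕ) [MOD m] := by
        rw [← hx, ← hy]
        exact Nat.ModEq.add_right _ h3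
      have h5 := Nat.ModEq.add_left_cancel' _ h4
      rw [Nat.ModEq, Nat.mod_eq_of_lt x.2, Nat.mod_eq_of_lt y.2] at h5
      exact Fin.ext h5
    exact (Function.Bijective.sum_comp (Finite.injective_iff_bijective.1 hinj) g)
  simp only [h2, sum_const, card_univ, nsmul_eq_mul] at h1
  apply mul_left_cancel₀ hm
  rw [← h1, ← mul_assoc, ← pow_succ', Nat.sub_add_cancel hn]
  simp

/-- The largest of the numbers `η_j csc(η_j π / 2m) |ĝ(j)|`, where `ĝ(j) = ∑_s g(s) ω_j ^ s`. -/
noncomputable def fourierMax {m : ℕ} [NeZero m] (g : Fin m → ℝ) : ℝ :=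
  univ.sup' univ_nonempty fun j : Fin m =>
    (etaGcd m j : ℝ) * csc ((etaGcd m j : ℝ) * Real.pi / (2 * m)) *
      ‖∑ s : Fin m, (g s : ℂ) * omegaRoot m j ^ (s : ℕ)‖

/-- A Fourier mode of a product correlator, with all inputs fixed but those of one party `i₀` of
the first group and of two parties `i₁`, `i₂` of the second: the first group contributes at most
`η_j csc(η_j π / 2m)`. -/
theorem norm_mode_le {n m : ℕ} [NeZero m] {S : Finset (Fin n)} {i₀ i₁ i₂ : Fin n}
    (h₀ : i₀ ∈ S) (h₁ : i₁ ∉ S) (h₂ : i₂ ∉ S) (h₁₂ : i₁ ≠ i₂)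
    {E F : (Fin n → Fin m) → ℝ}
    (hE : ∀ s t, (∀ i ∈ S, s i = t i) → E s = E t)
    (hF : ∀ s t, (∀ i ∉ S, s i = t i) → F s = F t)
    (hE1 : ∀ s, |E s| ≤ 1) (j : Fin m) (s : Fin n → Fin m) :
    ‖∑ x, ∑ y, ∑ z, (fun t => (omegaRoot m j)⁻¹ ^ total t * ((E t : ℂ) * F t))
        (Function.update (Function.update (Function.update s i₀ x) i₁ y) i₂ z)‖
      ≤ ((etaGcd m j : ℝ) * csc ((etaGcd m j : ℝ) * Real.pi / (2 * m))) *
        ‖∑ y : Fin m, ∑ z : Fin m, (omegaRoot m j)⁻¹ ^ (y : ℕ) * (omegaRoot m j)⁻¹ ^ (z : ℕ)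
          * (F (Function.update (Function.update s i₁ y) i₂ z) : ℂ)‖ := by
  have h₀₁ : i₀ ≠ i₁ := fun h => h₁ (h ▸ h₀)
  have h₀₂ : i₀ ≠ i₂ := fun h => h₂ (h ▸ h₀)
  have hm : 0 < m := Nat.pos_of_ne_zero (NeZero.ne m)
  set ω := (omegaRoot m j)⁻¹ with hω
  have hω1 : ‖ω‖ = 1 := by rw [hω, norm_inv, norm_omegaRoot, inv_one]
  have hω0 : ω ≠ 0 := inv_ne_zero (omegaRoot_ne_zero m j)
  set K : ℂ := ω ^ total s * (ω⁻¹) ^ ((s i₀ : ℕ) + s i₁ + s i₂) with hK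
  have hK1 : ‖K‖ = 1 := by simp [hK, hω1]
  have hterm : ∀ x y z, (fun t => ω ^ total t * ((E t : ℂ) * F t))
      (Function.update (Function.update (Function.update s i₀ x) i₁ y) i₂ z)
      = K * (((E (Function.update s i₀ x) : ℂ) * ω ^ (x : ℕ)) * (ω ^ (y : ℕ) * ω ^ (z : ℕ)
          * (F (Function.update (Function.update s i₁ y) i₂ z) : ℂ))) := by
    intro x y z
    have e1 : E (Function.update (Function.update (Function.update s i₀ x) i₁ y) i₂ z)
        = E (Function.update s i₀ x) := by
      refine hE _ _ fun i hi => ?_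
      rw [Function.update_of_ne (by rintro rfl; exact h₂ hi),
        Function.update_of_ne (by rintro rfl; exact h₁ hi)]
    have e2 : F (Function.update (Function.update (Function.update s i₀ x) i₁ y) i₂ z)
        = F (Function.update (Function.update s i₁ y) i₂ z) := by
      refine hF _ _ fun i hi => ?_
      have : i ≠ i₀ := by rintro rfl; exact hi h₀
      simp [Function.update_apply, this]
    have e3 : total (Function.update (Function.update (Function.update s i₀ x) i₁ y) i₂ z)
        + ((s i₀ : ℕ) + s i₁ + s i₂) = total s + x + y + z := by
      have t1 := total_update s i₀ x
      have t2 := total_update (Function.update s i₀ x) i₁ y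
      have t3 := total_update (Function.update (Function.update s i₀ x) i₁ y) i₂ z
      rw [Function.update_of_ne h₀₁.symm] at t2
      rw [Function.update_of_ne h₁₂.symm, Function.update_of_ne h₀₂.symm] at t3
      omega
    have e4 : ω ^ total (Function.update (Function.update (Function.update s i₀ x) i₁ y) i₂ z)
        = K * (ω ^ (x : ℕ) * ω ^ (y : ℕ) * ω ^ (z : ℕ)) := by
      have := congrArg (fun k : ℕ => ω ^ k) e3
      simp only [pow_add] at this
      have hinv : ω⁻¹ ^ ((s i₀ : ℕ) + s i₁ + s i₂) * (ω ^ (s i₀ : ℕ) * ω ^ (s i₁ : ℕ)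
          * ω ^ (s i₂ : ℕ)) = 1 := by
        rw [← pow_add, ← pow_add, ← mul_pow, inv_mul_cancel₀ hω0, one_pow]
      rw [hK]
      linear_combination (ω⁻¹ ^ ((s i₀ : ℕ) + s i₁ + s i₂)) * this
        - ω ^ total (Function.update (Function.update (Function.update s i₀ x) i₁ y) i₂ z) * hinv
    simp only [e1, e2, e4]
    ring
  simp only [hterm, ← mul_sum, ← sum_mul]
  rw [norm_mul K, hK1, one_mul, norm_mul]
  gcongr
  exact norm_sum_mul_omegaRoot_le hm j _ fun x => hE1 _

/-- The bound for a product of two correlators. Expanding in Fourier modes, one party of the first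
group yields the factor `η_j csc(η_j π / 2m)` for the mode `j`; the modes of the second group are
controlled in the `ℓ¹`-norm by `hF2`. -/
theorem sum_product_correlator_le {n m : ℕ} [NeZero m] (hn : 2 ≤ n) (g : Fin m → ℝ)
    {S : Finset (Fin n)} {i₀ i₁ i₂ : Fin n}
    (h₀ : i₀ ∈ S) (h₁ : i₁ ∉ S) (h₂ : i₂ ∉ S) (h₁₂ : i₁ ≠ i₂)
    {E F : (Fin n → Fin m) → ℝ}
    (hE : ∀ s t, (∀ i ∈ S, s i = t i) → E s = E t)
    (hF : ∀ s t, (∀ i ∉ S, s i = t i) → F s = F t)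
    (hE1 : ∀ s, |E s| ≤ 1)
    (hF2 : ∀ s, ∑ j : Fin m, ‖∑ y : Fin m, ∑ z : Fin m,
      (omegaRoot m j)⁻¹ ^ (y : ℕ) * (omegaRoot m j)⁻¹ ^ (z : ℕ)
        * (F (Function.update (Function.update s i₁ y) i₂ z) : ℂ)‖ ≤ (m : ℝ) ^ 2) :
    ∑ s : Fin n → Fin m, (-1) ^ (total s / m) * g (residue m (total s)) * (E s * F s)
      ≤ (m : ℝ) ^ (n - 2) * fourierMax g := by
  have hm : 0 < m := Nat.pos_of_ne_zero (NeZero.ne m)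
  have hm' : (0 : ℝ) < m := by exact_mod_cast hm
  set G : Fin m → ℂ := fun j => ∑ s : Fin m, (g s : ℂ) * omegaRoot m j ^ (s : ℕ) with hG
  set c : Fin m → ℝ := fun j =>
    (etaGcd m j : ℝ) * csc ((etaGcd m j : ℝ) * Real.pi / (2 * m)) with hc
  set D : Fin m → ℂ := fun j =>
    ∑ s : Fin n → Fin m, (omegaRoot m j)⁻¹ ^ total s * ((E s : ℂ) * F s) with hD
  set Q : Fin m → (Fin n → Fin m) → ℝ := fun j s => ‖∑ y : Fin m, ∑ z : Fin m,
      (omegaRoot m j)⁻¹ ^ (y : ℕ) * (omegaRoot m j)⁻¹ ^ (z : ℕ)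
        * (F (Function.update (Function.update s i₁ y) i₂ z) : ℂ)‖ with hQ
  set B : ℝ := ∑ s : Fin n → Fin m,
    (-1) ^ (total s / m) * g (residue m (total s)) * (E s * F s) with hB
  have hmode : (m : ℂ) * B = ∑ j, G j * D j := by
    have h : ∀ j, G j * D j = ∑ s : Fin n → Fin m,
        G j * (omegaRoot m j)⁻¹ ^ total s * ((E s : ℂ) * F s) := fun j => by
      simp only [hD, mul_sum, mul_assoc]
    simp only [h]
    rw [sum_comm, hB]
    push_cast
    rw [mul_sum]
    refine sum_congr rfl fun s _ => ?_
    rw [← sum_mul, fourier_inversion]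
    ring
  have hDle : ∀ j, (m : ℝ) ^ 3 * ‖D j‖ ≤ c j * ∑ s, Q j s := by
    intro j
    have h3 : (m : ℂ) ^ 3 * D j = ∑ s : Fin n → Fin m, ∑ x, ∑ y, ∑ z,
        (fun t => (omegaRoot m j)⁻¹ ^ total t * ((E t : ℂ) * F t))
        (Function.update (Function.update (Function.update s i₀ x) i₁ y) i₂ z) := by
      rw [sum_sum_update i₀ (fun s => ∑ y, ∑ z, (fun t => (omegaRoot m j)⁻¹ ^ total t
          * ((E t : ℂ) * F t)) (Function.update (Function.update s i₁ y) i₂ z)),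
        sum_sum_update i₁ (fun s => ∑ z, (fun t => (omegaRoot m j)⁻¹ ^ total t
          * ((E t : ℂ) * F t)) (Function.update s i₂ z)),
        sum_sum_update i₂ (fun t => (omegaRoot m j)⁻¹ ^ total t * ((E t : ℂ) * F t))]
      ring
    have h4 : (m : ℝ) ^ 3 * ‖D j‖ = ‖(m : ℂ) ^ 3 * D j‖ := by
      rw [norm_mul, norm_pow, Complex.norm_natCast]
    rw [h4, h3, mul_sum]
    exact (norm_sum_le _ _).trans (sum_le_sum fun s _ => norm_mode_le h₀ h₁ h₂ h₁₂ hE hF hE1 j s)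
  have hmax : ∀ j, c j * ‖G j‖ ≤ fourierMax g := fun j =>
    le_sup' (fun j : Fin m => c j * ‖G j‖) (mem_univ j)
  have hmax0 : 0 ≤ fourierMax g :=
    (mul_nonneg (etaGcd_mul_csc_nonneg hm _) (norm_nonneg _)).trans (hmax 0)
  have hfin : (m : ℝ) ^ 4 * B ≤ (m : ℝ) ^ (n + 2) * fourierMax g := by
    calc (m : ℝ) ^ 4 * B ≤ (m : ℝ) ^ 3 * ‖(m : ℂ) * B‖ := by
          rw [norm_mul, Complex.norm_natCast, Complex.norm_real, ← mul_assoc, ← pow_succ]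
          exact mul_le_mul_of_nonneg_left (le_abs_self B) (by positivity)
      _ ≤ (m : ℝ) ^ 3 * ∑ j, ‖G j‖ * ‖D j‖ := by
          rw [hmode]
          gcongr
          exact (norm_sum_le _ _).trans (sum_le_sum fun j _ => (norm_mul _ _).le)
      _ = ∑ j, ‖G j‖ * ((m : ℝ) ^ 3 * ‖D j‖) := by
          rw [mul_sum]
          exact sum_congr rfl fun j _ => by ring
      _ ≤ ∑ j, fourierMax g * ∑ s, Q j s := by
          refine sum_le_sum fun j _ => ?_
          refine (mul_le_mul_of_nonneg_left (hDle j) (norm_nonneg _)).trans ?_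
          rw [← mul_assoc, mul_comm ‖G j‖]
          exact mul_le_mul_of_nonneg_right (hmax j) (sum_nonneg fun s _ => norm_nonneg _)
      _ = fourierMax g * ∑ s, ∑ j, Q j s := by rw [← mul_sum, sum_comm]
      _ ≤ fourierMax g * ∑ _s : Fin n → Fin m, (m : ℝ) ^ 2 := by
          gcongr with s
          exact hF2 s
      _ = (m : ℝ) ^ (n + 2) * fourierMax g := by
          simp [pow_add]
          ring
  have hpow : (m : ℝ) ^ (n + 2) = (m : ℝ) ^ 4 * (m : ℝ) ^ (n - 2) := by
    rw [← pow_add]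
    congr 1
    omega
  rw [hpow, mul_assoc] at hfin
  exact le_of_mul_le_mul_left hfin (by positivity)

end Averaging

/-! ### Correlators of two-outcome measurements -/

section Correlator

open Finset

/-- The full correlator `∑_o (-1)^(∑ o) P(o | s)` of a correlation with two outcomes. -/
noncomputable def fullCorrelator {n m : ℕ} (P : Correlation n m 2) (s : Fin n → Fin m) : ℝ :=
  ∑ o, (-1) ^ total o * P s o

theorem residue_sub_val (t q : ℕ) :
    (((residue 2 (((residue 2 (t : ℤ) : Fin 2) : ℕ) - (q : ℤ)) : Fin 2) : ℕ) : ℝ)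
      = (1 - (-1) ^ q * (-1) ^ t) / 2 := by
  have h : ((residue 2 (((residue 2 (t : ℤ) : Fin 2) : ℕ) - (q : ℤ)) : Fin 2) : ℕ)
      = (t + q) % 2 := by
    rw [residue_natCast_val]
    simp only [residue]
    omega
  rw [h, ← pow_add, add_comm q t]
  rcases Nat.even_or_odd (t + q) with h2 | h2
  · rw [h2.neg_one_pow, Nat.even_iff.1 h2]
    norm_num
  · rw [h2.neg_one_pow, Nat.odd_iff.1 h2]
    norm_num

/-- For a normalized correlation, the Bell expression is an affine function of the full correlators,
whose coefficients are the antiperiodic extension of `g`. -/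
theorem bellExpr_eq {n m : ℕ} [NeZero m] (hn : 0 < n) (g : Fin m → ℝ) (P : Correlation n m 2)
    (hP : ∀ s, ∑ o, P s o = 1) :
    bellExpr (fun (s : Fin m) (r : Fin 2) => g s * ((r : ℕ) : ℝ)) P
      = 1 / 2 * ((m : ℝ) ^ (n - 1) * ∑ s, g s
        - ∑ s : Fin n → Fin m,
          (-1) ^ (total s / m) * g (residue m (total s)) * fullCorrelator P s) := by
  have key : ∀ s : Fin n → Fin m, ∑ r : Fin 2, g (residue m (total s))
      * (((residue 2 (((r : ℕ) : ℤ) - ((total s / m : ℕ) : ℤ)) : Fin 2) : ℕ) : ℝ)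
        * probTotal P s r
      = 1 / 2 * (g (residue m (total s))
        - (-1) ^ (total s / m) * g (residue m (total s)) * fullCorrelator P s) := by
    intro s
    have h1 : ∑ r : Fin 2, g (residue m (total s))
        * (((residue 2 (((r : ℕ) : ℤ) - ((total s / m : ℕ) : ℤ)) : Fin 2) : ℕ) : ℝ)
          * probTotal P s r
        = ∑ o, g (residue m (total s)) * ((1 - (-1) ^ (total s / m) * (-1) ^ total o) / 2)
          * P s o := by
      simp only [probTotal, mul_sum]
      rw [← sum_fiberwise univ (fun o : Fin n → Fin 2 => residue 2 (total o : ℤ))]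
      refine sum_congr rfl fun r _ => sum_congr rfl fun o ho => ?_
      rw [← (mem_filter.1 ho).2, residue_sub_val]
    have h2 : ∀ o, g (residue m (total s)) * ((1 - (-1) ^ (total s / m) * (-1) ^ total o) / 2)
        * P s o = 1 / 2 * g (residue m (total s)) * P s o
          - 1 / 2 * ((-1) ^ (total s / m) * g (residue m (total s))) * ((-1) ^ total o * P s o) :=
      fun o => by ring
    rw [h1, sum_congr rfl fun o _ => h2 o, sum_sub_distrib, ← mul_sum, ← mul_sum, hP,
      fullCorrelator]
    ring
  rw [bellExpr, sum_congr rfl fun s _ => key s, ← mul_sum, sum_sub_distrib, sum_residue_total hn]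

namespace Measurement

variable {κ : Type u}

/-- The operator `M₀ - M₁`, whose expectation value is that of `(-1) ^ r` for the outcome `r` of a
two-outcome measurement. -/
noncomputable def observable (M : Measurement κ 2) : L2 κ →L[ℂ] L2 κ :=
  M.effect 0 - M.effect 1

theorem isSelfAdjoint_observable (M : Measurement κ 2) : IsSelfAdjoint M.observable :=
  (M.isPositive 0).isSelfAdjoint.sub (M.isPositive 1).isSelfAdjoint

theorem effect_add (M : Measurement κ 2) : M.effect 0 + M.effect 1 = 1 := by
  rw [← M.sum_eq_one, Fin.sum_univ_two]

/-- The two effects commute, so that their product is positive. -/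
theorem re_inner_effect_nonneg (M : Measurement κ 2) (x : L2 κ) :
    0 ≤ (inner ℂ (M.effect 0 x) (M.effect 1 x)).re := by
  have hx : ∀ y, M.effect 0 y + M.effect 1 y = y := fun y => by
    rw [← add_apply, M.effect_add]
    rfl
  have hcomm : M.effect 1 (M.effect 0 x) = M.effect 0 (M.effect 1 x) := by
    have h1 := hx (M.effect 1 x)
    have h2 := congrArg (M.effect 1) (hx x)
    rw [map_add] at h2
    exact add_right_cancel (h2.trans h1.symm)
  have hsymm : inner ℂ (M.effect 0 x) (M.effect 1 (M.effect 1 x))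
      = inner ℂ (M.effect 0 (M.effect 1 x)) (M.effect 1 x) := by
    rw [← hcomm]
    exact ((M.isPositive 1).isSymmetric (M.effect 0 x) (M.effect 1 x)).symm
  have h3 : inner ℂ (M.effect 0 x) (M.effect 1 x)
      = inner ℂ (M.effect 0 x) (M.effect 1 (M.effect 0 x))
        + inner ℂ (M.effect 0 (M.effect 1 x)) (M.effect 1 x) := by
    rw [← hsymm, ← inner_add_right, ← map_add, hx]
  rw [h3, Complex.add_re]
  exact add_nonneg ((M.isPositive 1).re_inner_nonneg_right _)
    ((M.isPositive 0).re_inner_nonneg_left _)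

theorem norm_observable_le (M : Measurement κ 2) : ‖M.observable‖ ≤ 1 := by
  refine ContinuousLinearMap.opNorm_le_bound _ zero_le_one fun x => ?_
  have hx : M.effect 0 x + M.effect 1 x = x := by
    rw [← add_apply, M.effect_add]
    rfl
  have h1 := norm_add_sq (𝕜 := ℂ) (M.effect 0 x) (M.effect 1 x)
  have h2 := norm_sub_sq (𝕜 := ℂ) (M.effect 0 x) (M.effect 1 x)
  have h3 : 0 ≤ RCLike.re (inner ℂ (M.effect 0 x) (M.effect 1 x)) := M.re_inner_effect_nonneg x
  rw [hx] at h1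
  rw [one_mul]
  refine (sq_le_sq₀ (norm_nonneg _) (norm_nonneg _)).1 ?_
  change ‖M.effect 0 x - M.effect 1 x‖ ^ 2 ≤ _
  linarith

end Measurement

variable {n m : ℕ} {ι : Fin n → Type u}

theorem sum_tensorOp_effect (M : ∀ i, Measurement (ι i) 2) :
    ∑ o : Fin n → Fin 2, tensorOp (fun i => (M i).effect (o i)) = 1 := by
  have h := tensorOp_sum_smul (fun (_ : Fin n) (_ : Fin 2) => (1 : ℂ)) fun i => (M i).effect
  simp only [one_smul, prod_const_one, (M _).sum_eq_one] at h
  rw [← h, tensorOp_one]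

theorem sum_neg_one_pow_tensorOp_effect (M : ∀ i, Measurement (ι i) 2) :
    ∑ o : Fin n → Fin 2, (-1 : ℂ) ^ total o • tensorOp (fun i => (M i).effect (o i))
      = tensorOp fun i => (M i).observable := by
  have h := tensorOp_sum_smul (fun (_ : Fin n) (r : Fin 2) => (-1 : ℂ) ^ (r : ℕ))
    fun i => (M i).effect
  simp only [prod_pow_eq_pow_sum, Fin.sum_univ_two] at h
  refine h.symm.trans ?_
  congr 1
  funext i
  simp [Measurement.observable, sub_eq_add_neg]

theorem ofReal_re_inner_of_isSelfAdjoint {H : Type*} [NormedAddCommGroup H]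
    [InnerProductSpace ℂ H] [CompleteSpace H] {T : H →L[ℂ] H} (hT : IsSelfAdjoint T) (x : H) :
    ((inner ℂ x (T x)).re : ℂ) = inner ℂ x (T x) := by
  apply Complex.conj_eq_iff_re.1
  rw [inner_conj_symm, ← ContinuousLinearMap.adjoint_inner_right,
    ContinuousLinearMap.isSelfAdjoint_iff'.1 hT]

/-- The bound for a vector which is a product across `S`, when at least two parties are outside
`S`. -/
theorem sum_correlator_le_of_product [NeZero m] (hn : 2 ≤ n) (g : Fin m → ℝ)
    {A : ∀ i, Fin m → (L2 (ι i) →L[ℂ] L2 (ι i))} (hA : ∀ i s, IsSelfAdjoint (A i s))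
    (hA1 : ∀ i s, ‖A i s‖ ≤ 1) {ψ : L2 (∀ j, ι j)} (hψ : ‖ψ‖ = 1)
    {S : Finset (Fin n)} (hS : SharesComplFactor S ψ ψ) {i₀ i₁ i₂ : Fin n}
    (h₀ : i₀ ∈ S) (h₁ : i₁ ∉ S) (h₂ : i₂ ∉ S) (h₁₂ : i₁ ≠ i₂) :
    ∑ s : Fin n → Fin m, (-1) ^ (total s / m) * g (residue m (total s))
        * (inner ℂ ψ (tensorOp (fun i => A i (s i)) ψ)).re
      ≤ (m : ℝ) ^ (n - 2) * fourierMax g := by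
  -- Operators acting only on the parties satisfying `p`.
  let R : (Fin n → Prop) → (Fin n → Fin m) → ∀ i, L2 (ι i) →L[ℂ] L2 (ι i) := fun p s i =>
    open Classical in if p i then A i (s i) else 1
  have hRsa : ∀ p s i, IsSelfAdjoint (R p s i) := fun p s i => by
    by_cases h : p i
    · simpa only [R, h, if_true] using hA i (s i)
    · simpa only [R, h, if_false] using IsSelfAdjoint.one _
  have hR1 : ∀ p s i, ‖R p s i‖ ≤ 1 := fun p s i => by
    by_cases h : p i
    · simpa only [R, h, if_true] using hA1 i (s i)
    · simp only [R, h, if_false]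
      exact ContinuousLinearMap.norm_id_le
  have hRle : ∀ p s, ‖tensorOp (R p s) ψ‖ ≤ 1 := fun p s =>
    (norm_tensorOp_apply_le (hR1 p s) ψ).trans hψ.le
  have hRcongr : ∀ p s t, (∀ i, p i → s i = t i) → R p s = R p t := fun p s t h => by
    funext i
    by_cases hp : p i
    · simp only [R, hp, if_true, h i hp]
    · simp only [R, hp, if_false]
  set E : (Fin n → Fin m) → ℝ := fun s => (inner ℂ ψ (tensorOp (R (· ∈ S) s) ψ)).re with hE
  set F : (Fin n → Fin m) → ℝ := fun s => (inner ℂ ψ (tensorOp (R (· ∉ S) s) ψ)).re with hF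
  have hEF : ∀ s : Fin n → Fin m,
      (inner ℂ ψ (tensorOp (fun i => A i (s i)) ψ)).re = E s * F s := by
    intro s
    have h1 : tensorOp (fun i => A i (s i)) ψ
        = tensorOp (R (· ∈ S) s) (tensorOp (R (· ∉ S) s) ψ) := by
      rw [← mul_apply_eq_comp, tensorOp_mul]
      congr 2
      funext i
      by_cases h : i ∈ S <;> simp [R, h]
    rw [h1, inner_tensorOp_mul_of_product (M := R (· ∈ S) s) (N := R (· ∉ S) s) hS hψ
      (fun i hi => if_neg hi) (fun i hi => if_neg (not_not.2 hi)) (hRsa _ _),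
      ← ofReal_re_inner_of_isSelfAdjoint (isSelfAdjoint_tensorOp (hRsa (· ∈ S) s)),
      ← ofReal_re_inner_of_isSelfAdjoint (isSelfAdjoint_tensorOp (hRsa (· ∉ S) s)),
      ← Complex.ofReal_mul, Complex.ofReal_re]
  simp only [hEF]
  refine sum_product_correlator_le hn g h₀ h₁ h₂ h₁₂ (fun s t h => ?_) (fun s t h => ?_)
    (fun s => ?_) fun s => ?_
  · simp only [hE, hRcongr _ s t h]
  · simp only [hF, hRcongr _ s t h]
  · refine (Complex.abs_re_le_norm _).trans ((norm_inner_le_norm _ _).trans ?_)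
    rw [hψ, one_mul]
    exact hRle _ _
  · -- The operator of the party `i₁` is split off from those of the other parties outside `S`.
    have hsplit : ∀ y z,
        (F (Function.update (Function.update s i₁ y) i₂ z) : ℂ)
          = inner ℂ ψ (tensorOp (R (· = i₁) fun _ => y)
            (tensorOp (R (fun i => i ∉ S ∧ i ≠ i₁) (Function.update s i₂ z)) ψ)) := by
      intro y z
      simp only [hF]
      rw [ofReal_re_inner_of_isSelfAdjoint (isSelfAdjoint_tensorOp (hRsa _ _)),
        ← mul_apply_eq_comp, tensorOp_mul]
      congr 3
      funext i
      by_cases hi : i = i₁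
      · subst hi
        simp [R, h₁, h₁₂]
      · simp [R, hi, Function.update_apply]
    simp only [hsplit]
    refine sum_norm_bipartite_fourier_le ψ
      (fun y => tensorOp (R (· = i₁) fun _ => y))
      (fun z => tensorOp (R (fun i => i ∉ S ∧ i ≠ i₁) (Function.update s i₂ z)))
      (fun y => ?_) fun z => hRle _ _
    rw [ContinuousLinearMap.isSelfAdjoint_iff'.1 (isSelfAdjoint_tensorOp (hRsa _ _))]
    exact hRle _ _

/-- The bound for biseparable pure states: of the two groups one has at least two members. -/
theorem sum_correlator_le_of_biseparable [NeZero m] (hn : 3 ≤ n) (g : Fin m → ℝ)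
    {A : ∀ i, Fin m → (L2 (ι i) →L[ℂ] L2 (ι i))} (hA : ∀ i s, IsSelfAdjoint (A i s))
    (hA1 : ∀ i s, ‖A i s‖ ≤ 1) {ψ : L2 (∀ j, ι j)} (hψ : IsBiseparableVector ψ) :
    ∑ s : Fin n → Fin m, (-1) ^ (total s / m) * g (residue m (total s))
        * (inner ℂ ψ (tensorOp (fun i => A i (s i)) ψ)).re
      ≤ (m : ℝ) ^ (n - 2) * fourierMax g := by
  obtain ⟨hnorm, S, ⟨a, ha⟩, ⟨b, hb⟩, hprod⟩ := hψ
  have hS := hprod.sharesComplFactor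
  have hcard : S.card + Sᶜ.card = n := by rw [card_add_card_compl, Fintype.card_fin]
  rcases le_or_gt 2 Sᶜ.card with h | h
  · obtain ⟨i₁, h₁, i₂, h₂, h₁₂⟩ := one_lt_card.1 h
    exact sum_correlator_le_of_product (by omega) g hA hA1 hnorm hS ha (mem_compl.1 h₁)
      (mem_compl.1 h₂) h₁₂
  · obtain ⟨i₁, h₁, i₂, h₂, h₁₂⟩ := one_lt_card.1 (show 1 < S.card by omega)
    exact sum_correlator_le_of_product (by omega) g hA hA1 hnorm hS.self_compl hb
      (by simpa using h₁) (by simpa using h₂) h₁₂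

end Correlator

/-! ### Mixtures -/

open MeasureTheory in
theorem mainTheorem4 (n m : ℕ) [NeZero m] (hn : 3 ≤ n) (g : Fin m → ℝ)
    (P : Correlation n m 2) (hP : IsQuantumBiseparable.{u, v} P) :
    bellExpr (fun (s : Fin m) (r : Fin 2) => g s * ((r : ℕ) : ℝ)) P ≥
      1 / 2 * (m : ℝ) ^ (n - 2) *
        ((m : ℝ) * ∑ s : Fin m, g s -
          Finset.univ.sup' Finset.univ_nonempty (fun j : Fin m =>
            (etaGcd m j : ℝ) * csc ((etaGcd m j : ℝ) * Real.pi / (2 * m)) *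
              ‖∑ s : Fin m, (g s : ℂ) * omegaRoot m j ^ (s : ℕ)‖)) := by
  obtain ⟨ι, M, Λ, _, μ, _, ψ, hψm, hψ, hPe⟩ := hP
  have hint : ∀ T : L2 (∀ i, ι i) →L[ℂ] L2 (∀ i, ι i),
      Integrable (fun l => (inner ℂ (ψ l) (T (ψ l))).re) μ := by
    intro T
    have hmeas : StronglyMeasurable fun l => (inner ℂ (ψ l) (T (ψ l))).re :=
      Complex.continuous_re.comp_stronglyMeasurable
        (hψm.inner (T.continuous.comp_stronglyMeasurable hψm))
    refine Integrable.of_bound hmeas.aestronglyMeasurable ‖T‖ (Filter.Eventually.of_forall ?_)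
    intro l
    refine (Complex.abs_re_le_norm _).trans ((norm_inner_le_norm _ _).trans ?_)
    have := T.le_opNorm (ψ l)
    rw [(hψ l).1, mul_one] at this
    rwa [(hψ l).1, one_mul]
  -- Linear combinations of probabilities are integrals of expectation values.
  have hlin : ∀ (c : (Fin n → Fin 2) → ℝ) (s : Fin n → Fin m),
      ∑ o, c o * P s o = ∫ l, (inner ℂ (ψ l)
        ((∑ o, (c o : ℂ) • tensorOp fun i => (M i (s i)).effect (o i)) (ψ l))).re ∂μ := by
    intro c s
    simp only [hPe, ← integral_const_mul]
    rw [← integral_finsetSum _ fun o _ => (hint _).const_mul _]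
    congr 1
    funext l
    rw [sum_apply, inner_sum, Complex.re_sum]
    refine Finset.sum_congr rfl fun o _ => ?_
    rw [smul_apply, inner_smul_right, Complex.re_ofReal_mul]
  have hnorm : ∀ s, ∑ o, P s o = 1 := by
    intro s
    have h := hlin (fun _ => 1) s
    simp only [one_mul, Complex.ofReal_one, one_smul,
      sum_tensorOp_effect fun i => M i (s i)] at h
    have h1 : ∀ l, (inner ℂ (ψ l) ((1 : L2 (∀ i, ι i) →L[ℂ] L2 (∀ i, ι i)) (ψ l))).re = 1 :=
      fun l => by
        rw [one_apply_eq_self, inner_self_eq_norm_sq_to_K, (hψ l).1]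
        simp
    simp only [h, h1, integral_const, probReal_univ, one_smul]
  have hcorr : ∀ s, fullCorrelator P s = ∫ l, (inner ℂ (ψ l)
      (tensorOp (fun i => (M i (s i)).observable) (ψ l))).re ∂μ := by
    intro s
    rw [fullCorrelator, hlin fun o => (-1) ^ total o,
      ← sum_neg_one_pow_tensorOp_effect fun i => M i (s i)]
    simp
  have hbound : ∑ s : Fin n → Fin m,
      (-1) ^ (total s / m) * g (residue m (total s)) * fullCorrelator P s
      ≤ (m : ℝ) ^ (n - 2) * fourierMax g := by
    simp only [hcorr, ← integral_const_mul]
    rw [← integral_finsetSum _ fun s _ => (hint _).const_mul _]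
    calc _ ≤ ∫ _, (m : ℝ) ^ (n - 2) * fourierMax g ∂μ :=
          integral_mono (integrable_finsetSum _ fun s _ => (hint _).const_mul _)
            (integrable_const _) fun l =>
              sum_correlator_le_of_biseparable (A := fun i s => (M i s).observable) hn g
                (fun i s => (M i s).isSelfAdjoint_observable)
                (fun i s => (M i s).norm_observable_le) (hψ l)
      _ = _ := by simp
  rw [bellExpr_eq (by omega) g P hnorm, ge_iff_le]
  change 1 / 2 * (m : ℝ) ^ (n - 2) * ((m : ℝ) * ∑ s : Fin m, g s - fourierMax g) ≤ _
  have hpow : (m : ℝ) ^ (n - 1) = (m : ℝ) ^ (n - 2) * m := by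
    rw [← pow_succ]
    congr 1
    omega
  rw [hpow]
  linarith
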